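/- Let $E \neq \{0\}$ be a complex Banach space and let $V \subseteq E$ be a bounded, open, balanced, convex set containing $0$. Let $H^\infty(V)$ be the space of bounded holomorphic functions $f : V \to \mathbb{C}$, let $\mathcal{A}_\infty(V)$ be the space of those $f \in H^\infty(V)$ which extend continuously to the closure $\overline{V}$, and let $\mathcal{A}_u(V)$ be the space of those $f \in H^\infty(V)$ which are uniformly continuous on $V$, each with the norm $\|f\| = \sup_{x \in V} |f(x)|$. Then $X = \mathcal{A}_u(V)$, $X = \mathcal{A}_\infty(V)$ and $X = H^\infty(V)$ all have the Daugavet property, that is, $\|T + I\| = 1 + \|T\|$ for every bounded linear operator $T : X \to X$ of rank one, where $I$ is the identity of $X$. -/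

import Mathlib

open scoped BoundedContinuousFunction

/-- A normed space `X` has the Daugavet property if `‖T + I‖ = 1 + ‖T‖` for every bounded
linear operator `T : X → X` of rank one. -/
def DaugavetProperty (𝕜 X : Type*) [RCLike 𝕜] [NormedAddCommGroup X] [NormedSpace 𝕜 X] : Prop :=
  ∀ T : X →L[𝕜] X, Module.finrank 𝕜 (LinearMap.range (T : X →ₗ[𝕜] X)) = 1 →
    ‖T + ContinuousLinearMap.id 𝕜 X‖ = 1 + ‖T‖

/-- `f : V → ℂ` is holomorphic on `V`, i.e. complex Fréchet differentiable at every point of `V`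
(this is meant for open `V`, where the values of the extension `F` off `V` play no role). -/
def IsHolomorphicOn {E : Type*} [NormedAddCommGroup E] [NormedSpace ℂ E] (V : Set E)
    (f : V → ℂ) : Prop :=
  ∃ F : E → ℂ, DifferentiableOn ℂ F V ∧ ∀ x : V, F x = f x

/-- `f : V → ℂ` extends to a continuous function on the closure of `V`. -/
def ExtendsContinuouslyToClosure {E : Type*} [TopologicalSpace E] (V : Set E)
    (f : V → ℂ) : Prop :=
  ∃ F : E → ℂ, ContinuousOn F (closure V) ∧ ∀ x : V, F x = f x

/-- The algebra `H^∞(V)` of bounded holomorphic functions on `V`. The norm it inherits from the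
bounded continuous functions on `V` is the supremum norm on `V`. -/
def HInfty {E : Type*} [NormedAddCommGroup E] [NormedSpace ℂ E] (V : Set E) :
    Subalgebra ℂ (V →ᵇ ℂ) where
  carrier := {f | IsHolomorphicOn V f}
  mul_mem' := by
    rintro f g ⟨F, hF, hFf⟩ ⟨G, hG, hGg⟩
    exact ⟨fun x => F x * G x, hF.mul hG, fun x => by simp [hFf, hGg]⟩
  add_mem' := by
    rintro f g ⟨F, hF, hFf⟩ ⟨G, hG, hGg⟩
    exact ⟨fun x => F x + G x, hF.add hG, fun x => by simp [hFf, hGg]⟩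
  algebraMap_mem' := fun c => ⟨fun _ => c, differentiableOn_const c, fun x => by simp⟩

/-- The algebra `𝒜_∞(V)` of those functions in `H^∞(V)` which extend continuously to the closure
of `V`, with the supremum norm on `V`. -/
def AInfty {E : Type*} [NormedAddCommGroup E] [NormedSpace ℂ E] (V : Set E) :
    Subalgebra ℂ (V →ᵇ ℂ) where
  carrier := {f | f ∈ HInfty V ∧ ExtendsContinuouslyToClosure V f}
  mul_mem' := by
    rintro f g ⟨hf, F, hF, hFf⟩ ⟨hg, G, hG, hGg⟩
    exact ⟨mul_mem hf hg, fun x => F x * G x, hF.mul hG, fun x => by simp [hFf, hGg]⟩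
  add_mem' := by
    rintro f g ⟨hf, F, hF, hFf⟩ ⟨hg, G, hG, hGg⟩
    exact ⟨add_mem hf hg, fun x => F x + G x, hF.add hG, fun x => by simp [hFf, hGg]⟩
  algebraMap_mem' := fun c =>
    ⟨(HInfty V).algebraMap_mem c, fun _ => c, continuousOn_const, fun x => by simp⟩

/-- A product of two bounded uniformly continuous functions is uniformly continuous. -/
theorem uniformContinuous_mul_of_bounded {α : Type*} [PseudoMetricSpace α] (f g : α →ᵇ ℂ)
    (hf : UniformContinuous f) (hg : UniformContinuous g) :
    UniformContinuous (f * g : α →ᵇ ℂ) := by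
  rw [Metric.uniformContinuous_iff] at *
  intro ε hε
  set C := ‖f‖ + ‖g‖ + 1 with hC
  have hCpos : 0 < C := by positivity
  obtain ⟨δ₁, h₁, H₁⟩ := hf (ε / (2 * C)) (by positivity)
  obtain ⟨δ₂, h₂, H₂⟩ := hg (ε / (2 * C)) (by positivity)
  refine ⟨min δ₁ δ₂, lt_min h₁ h₂, fun {a b} hab => ?_⟩
  have k₁ := H₁ (hab.trans_le (min_le_left _ _))
  have k₂ := H₂ (hab.trans_le (min_le_right _ _))
  rw [dist_eq_norm] at k₁ k₂ ⊢
  have e : (f * g : α →ᵇ ℂ) a - (f * g : α →ᵇ ℂ) b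
      = f a * (g a - g b) + (f a - f b) * g b := by
    simp only [BoundedContinuousFunction.coe_mul, Pi.mul_apply]; ring
  have b₁ : ‖f a‖ ≤ C := (f.norm_coe_le_norm a).trans (by linarith [norm_nonneg g])
  have b₂ : ‖g b‖ ≤ C := (g.norm_coe_le_norm b).trans (by linarith [norm_nonneg f])
  rw [e]
  calc ‖f a * (g a - g b) + (f a - f b) * g b‖
      ≤ ‖f a‖ * ‖g a - g b‖ + ‖f a - f b‖ * ‖g b‖ := by
        refine (norm_add_le _ _).trans (by rw [norm_mul, norm_mul])
    _ ≤ C * ‖g a - g b‖ + ‖f a - f b‖ * C := by gcongr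
    _ < C * (ε / (2 * C)) + (ε / (2 * C)) * C := by gcongr
    _ = ε := by field_simp; ring

/-- The algebra `𝒜_u(V)` of those functions in `H^∞(V)` which are uniformly continuous on `V`,
with the supremum norm on `V`. -/
def AUnif {E : Type*} [NormedAddCommGroup E] [NormedSpace ℂ E] (V : Set E) :
    Subalgebra ℂ (V →ᵇ ℂ) where
  carrier := {f | f ∈ HInfty V ∧ UniformContinuous f}
  mul_mem' := by
    rintro f g ⟨hf, hf'⟩ ⟨hg, hg'⟩
    exact ⟨mul_mem hf hg, uniformContinuous_mul_of_bounded f g hf' hg'⟩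
  add_mem' := by
    rintro f g ⟨hf, hf'⟩ ⟨hg, hg'⟩
    exact ⟨add_mem hf hg, hf'.add hg'⟩
  algebraMap_mem' := fun c => ⟨(HInfty V).algebraMap_mem c, uniformContinuous_const⟩

open Filter Topology

/-! Write a rank-one operator as `T f = φ f • g` with `‖g‖ = 1`, and let `f₀` in the unit ball
nearly norm `φ`, with `φ f₀ ≥ 0`. It suffices to change `f₀` into an `f` of norm almost at most one,
with almost the same `φ`-value, such that `f` and `g` are both close to one number `c` of modulus
almost one at a common point: then `‖f + r • g‖` is almost `1 + r`.

Take `f = f₀ + (h n - h m) * (c - f₀)` with peak functions `h n` whose values lie close to `[0, 1]`,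
`h m` being much narrower than `h n`. The bounded scalars `φ (h n * (c - f₀))` have a convergent
subsequence, so the difference makes the change in `φ` small. At a point where `h n ≈ 1` and `h m ≈
0` one has `f ≈ c`, and elsewhere `f` is nearly a convex combination of `f₀` and `c`
(`daugavetProperty_of_peak`).

The peaks are `discPeak` composed with a functional `ψ` satisfying `‖ψ‖ < 1` on `V`. The maximum
principle on a complex disc through a near-maximum point of `g` gives points where `ψ → 1` and `g →
c` (`exists_dual_tendsto_one`). These peaks belong to all three algebras, so one argument covers
them. -/

/-! ### Reduction of the Daugavet property to peak functions. -/

theorem daugavetProperty_of_approx {X : Type*} [NormedAddCommGroup X] [NormedSpace ℂ X]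
    (H : ∀ (φ : X →L[ℂ] ℂ) (g f₀ : X), ‖g‖ = 1 → ‖f₀‖ ≤ 1 → ∀ δ > 0, ∃ f : X,
      ‖f‖ ≤ 1 + δ ∧ ‖φ f - φ f₀‖ ≤ δ ∧ ∀ r : ℝ, 0 ≤ r → (1 + r) * (1 - δ) ≤ ‖f + (r : ℂ) • g‖) :
    DaugavetProperty ℂ X := by
  intro T hT
  refine le_antisymm ((norm_add_le _ _).trans ?_) ?_
  · linarith [ContinuousLinearMap.norm_id_le (𝕜 := ℂ) (E := X)]
  obtain ⟨⟨v, hvT⟩, hv0, hv⟩ := finrank_eq_one_iff'.1 hT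
  have hv0' : v ≠ 0 := fun h => hv0 (Subtype.ext h)
  have hvn : ‖v‖ ≠ 0 := norm_ne_zero_iff.2 hv0'
  obtain ⟨g, hg, hTg⟩ : ∃ g : X, ‖g‖ = 1 ∧ ∀ f, ∃ a : ℂ, T f = a • g := by
    refine ⟨((‖v‖ : ℂ)⁻¹) • v, ?_, fun f => ?_⟩
    · rw [norm_smul]; simp [hvn]
    · obtain ⟨a, ha⟩ := hv ⟨T f, f, rfl⟩
      refine ⟨a * ‖v‖, ?_⟩
      have : T f = a • v := (congrArg Subtype.val ha).symm
      rw [this, smul_smul, mul_assoc, mul_inv_cancel₀ (by exact_mod_cast hvn), mul_one]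
  -- Since `ψ g = 1`, the functional `ψ ∘ T` reads off the coefficient of `T f` along `g`.
  obtain ⟨ψ, -, hψ⟩ := exists_dual_vector ℂ g (by rw [← norm_ne_zero_iff, hg]; simp)
  set φ : X →L[ℂ] ℂ := ψ.comp T with hφ
  have hTφ : ∀ f, T f = φ f • g := by
    intro f
    obtain ⟨a, ha⟩ := hTg f
    simp [hφ, ha, hψ, hg]
  have key : ∀ δ : ℝ, 0 < δ → δ < 1 →
      (1 + (‖T‖ - δ)) * (1 - δ) - δ ≤ ‖T + ContinuousLinearMap.id ℂ X‖ * (1 + δ) := by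
    intro δ hδ hδ1
    obtain ⟨f₁, hf₁, hTf₁⟩ := T.exists_lt_apply_of_lt_opNorm (r := ‖T‖ - δ) (by linarith)
    rw [hTφ, norm_smul, hg, mul_one] at hTf₁
    -- Rotating `f₁` makes its `φ`-value equal to the nonnegative real `‖φ f₁‖`, which then serves
    -- as `r`.
    obtain ⟨θ, hθ, hθf⟩ := RCLike.exists_norm_eq_mul_self (φ f₁)
    obtain ⟨f, hf, hφf, hfg⟩ := H φ g (θ • f₁) hg (by rw [norm_smul, hθ]; linarith) δ hδ
    have h1 := hfg ‖φ f₁‖ (norm_nonneg _)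
    have h2 : ‖f + ((‖φ f₁‖ : ℝ) : ℂ) • g‖ ≤
        ‖(T + ContinuousLinearMap.id ℂ X) f‖ + ‖φ f - φ (θ • f₁)‖ := by
      have e : f + ((‖φ f₁‖ : ℝ) : ℂ) • g =
          (T + ContinuousLinearMap.id ℂ X) f - (φ f - φ (θ • f₁)) • g := by
        have : ((‖φ f₁‖ : ℝ) : ℂ) = θ * φ f₁ := hθf
        rw [this]
        simp only [add_apply, ContinuousLinearMap.id_apply, hTφ f, map_smul,
          smul_eq_mul, sub_smul]
        abel
      rw [e]
      refine (norm_sub_le _ _).trans ?_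
      rw [norm_smul, hg, mul_one]
    have h3 := (T + ContinuousLinearMap.id ℂ X).le_opNorm f
    have h4 : ‖T + ContinuousLinearMap.id ℂ X‖ * ‖f‖ ≤
        ‖T + ContinuousLinearMap.id ℂ X‖ * (1 + δ) := by gcongr
    have h5 : (1 + (‖T‖ - δ)) * (1 - δ) ≤ (1 + ‖φ f₁‖) * (1 - δ) := by
      apply mul_le_mul_of_nonneg_right <;> linarith
    linarith
  have hl : Tendsto (fun δ : ℝ => (1 + (‖T‖ - δ)) * (1 - δ) - δ) (𝓝[>] 0)
      (𝓝 ((1 + (‖T‖ - 0)) * (1 - 0) - 0)) :=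
    (Continuous.tendsto (by fun_prop) 0).mono_left nhdsWithin_le_nhds
  have hr : Tendsto (fun δ : ℝ => ‖T + ContinuousLinearMap.id ℂ X‖ * (1 + δ)) (𝓝[>] 0)
      (𝓝 (‖T + ContinuousLinearMap.id ℂ X‖ * (1 + 0))) :=
    (Continuous.tendsto (by fun_prop) 0).mono_left nhdsWithin_le_nhds
  have := le_of_tendsto_of_tendsto hl hr (by
    filter_upwards [Ioo_mem_nhdsGT (zero_lt_one' ℝ)] with δ hδ using key δ hδ.1 hδ.2)
  simpa using this

/-- A subalgebra of bounded functions has the Daugavet property as soon as each of its norm one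
elements is almost constant of modulus almost one near some point at which there is a sequence
of narrower and narrower peak functions with values close to `[0, 1]`. -/
theorem daugavetProperty_of_peak {S : Type*} [TopologicalSpace S] (X : Subalgebra ℂ (S →ᵇ ℂ))
    (H : ∀ g ∈ X, ‖g‖ = 1 → ∀ δ > 0, ∃ (c : ℂ) (h : ℕ → S →ᵇ ℂ), ‖c‖ ≤ 1 ∧ 1 - δ ≤ ‖c‖ ∧
      (∀ n, h n ∈ X) ∧ (∀ n x, ‖h n x‖ ≤ 1) ∧ (∀ n x, ‖h n x‖ + ‖1 - h n x‖ ≤ 1 + δ) ∧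
      (∀ n, ∀ᶠ m in atTop, ∀ x, ‖(1 - h n x) * h m x‖ ≤ δ) ∧
      ∀ n, ∃ x, ‖1 - h n x‖ ≤ δ ∧ ‖g x - c‖ ≤ δ ∧ ∀ᶠ m in atTop, ‖h m x‖ ≤ δ) :
    DaugavetProperty ℂ X := by
  refine daugavetProperty_of_approx fun φ g f₀ hg hf₀ ε hε => ?_
  -- The factor 5 comes from the lower bound: `δ` from `‖c‖` and `4 * δ` from `f x ≈ c`. The upper
  -- bound on the norm costs only `4 * δ`.
  obtain ⟨δ, hδ, hδ1, hδε⟩ : ∃ δ : ℝ, 0 < δ ∧ δ ≤ 1 ∧ 5 * δ ≤ ε :=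
    ⟨min 1 (ε / 5), by positivity, min_le_left _ _, by linarith [min_le_right 1 (ε / 5)]⟩
  obtain ⟨c, h, hc, hc', hX, hle, hseg, hsep, hpt⟩ := H g g.2 hg δ hδ
  set k : X := algebraMap ℂ X c - f₀ with hk
  set H' : ℕ → X := fun n => ⟨h n, hX n⟩ with hH'
  have hbd : ∀ n, φ (H' n * k) ∈ Metric.closedBall (0 : ℂ) (‖φ‖ * (1 * ‖k‖)) := by
    intro n
    rw [mem_closedBall_zero_iff]
    refine (φ.le_opNorm _).trans ?_
    gcongr
    refine (norm_mul_le _ _).trans ?_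
    gcongr
    exact (BoundedContinuousFunction.norm_le zero_le_one).2 (hle n)
  -- No single `φ (H' n * k)` need be small, but two late terms of a convergent subsequence differ
  -- by little.
  obtain ⟨a, -, σ, hσ, hlim⟩ := tendsto_subseq_of_bounded Metric.isBounded_closedBall hbd
  have hclose : ∀ᶠ j in atTop, dist (φ (H' (σ j) * k)) a < δ / 2 :=
    hlim.eventually (Metric.ball_mem_nhds a (half_pos hδ))
  obtain ⟨i, hi⟩ := hclose.exists
  obtain ⟨x, hx1, hxc, hx0⟩ := hpt (σ i)
  obtain ⟨j, hj, hjsep, hjx⟩ := (hclose.and ((hσ.tendsto_atTop.eventually (hsep (σ i))).and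
    (hσ.tendsto_atTop.eventually hx0))).exists
  set n := σ i
  set m := σ j
  have hf₀x : ∀ y, ‖(f₀ : S →ᵇ ℂ) y‖ ≤ 1 := fun y =>
    ((f₀ : S →ᵇ ℂ).norm_coe_le_norm y).trans hf₀
  have hfval : ∀ y, ((f₀ + (H' n - H' m) * k : X) : S →ᵇ ℂ) y =
      (1 - (h n y - h m y)) * (f₀ : S →ᵇ ℂ) y + (h n y - h m y) * c := by
    intro y
    simp [hk, hH']
    ring
  refine ⟨f₀ + (H' n - H' m) * k, ?_, ?_, fun r hr => ?_⟩
  · refine (BoundedContinuousFunction.norm_le (by positivity)).2 fun y => ?_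
    change ‖((f₀ + (H' n - H' m) * k : X) : S →ᵇ ℂ) y‖ ≤ _
    rw [hfval]
    have e1 := hseg n y
    have e2 := hseg m y
    have e3 := hjsep y
    -- As `(1 - h n) * h m` is small, the weights `h n - h m` and `1 - (h n - h m)` are nearly `h n
    -- * (1 - h m)` and `(1 - h n) + h n * h m`. By `hseg`, used for `m` and then for `n`, their
    -- moduli sum to almost at most one.
    have b1 : ‖h n y - h m y‖ ≤ ‖h n y‖ * ‖1 - h m y‖ + δ := by
      have : h n y - h m y = h n y * (1 - h m y) - (1 - h n y) * h m y := by ring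
      rw [this, ← norm_mul]
      exact (norm_sub_le _ _).trans (by linarith)
    have b2 : ‖1 - (h n y - h m y)‖ ≤ ‖1 - h n y‖ + ‖h n y‖ * ‖h m y‖ + δ := by
      have : 1 - (h n y - h m y) = (1 - h n y) + h n y * h m y + (1 - h n y) * h m y := by ring
      rw [this, ← norm_mul]
      exact norm_add₃_le.trans (by linarith)
    have b3 : ‖h n y‖ * (‖h m y‖ + ‖1 - h m y‖) ≤ ‖h n y‖ * (1 + δ) := by gcongr
    have b4 : ‖h n y‖ * δ ≤ 1 * δ := by gcongr; exact hle n y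
    calc _ ≤ ‖1 - (h n y - h m y)‖ * ‖(f₀ : S →ᵇ ℂ) y‖ + ‖h n y - h m y‖ * ‖c‖ := by
          rw [← norm_mul, ← norm_mul]; exact norm_add_le _ _
      _ ≤ ‖1 - (h n y - h m y)‖ * 1 + ‖h n y - h m y‖ * 1 := by gcongr; exact hf₀x y
      _ ≤ 1 + ε := by nlinarith
  · have : φ (f₀ + (H' n - H' m) * k) - φ f₀ = φ (H' n * k) - φ (H' m * k) := by
      rw [sub_mul, map_add, map_sub]; ring
    rw [this, ← dist_eq_norm]
    have := dist_triangle_right (φ (H' n * k)) (φ (H' m * k)) a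
    linarith
  · set f : X := f₀ + (H' n - H' m) * k with hf
    have hfx : ‖(f : S →ᵇ ℂ) x - c‖ ≤ 4 * δ := by
      have e : (f : S →ᵇ ℂ) x - c = ((1 - h n x) + h m x) * ((f₀ : S →ᵇ ℂ) x - c) := by
        rw [hfval]; ring
      rw [e, norm_mul]
      have e1 : ‖1 - h n x + h m x‖ ≤ 2 * δ := (norm_add_le _ _).trans (by linarith)
      have e2 : ‖(f₀ : S →ᵇ ℂ) x - c‖ ≤ 2 := (norm_sub_le _ _).trans (by linarith [hf₀x x])
      calc _ ≤ 2 * δ * 2 := by gcongr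
        _ = 4 * δ := by ring
    have hnorm : ‖((f + (r : ℂ) • g : X) : S →ᵇ ℂ) x‖ ≤ ‖f + (r : ℂ) • g‖ :=
      ((f + (r : ℂ) • g : X) : S →ᵇ ℂ).norm_coe_le_norm x
    have hval : (1 + (r : ℂ)) * c = ((f + (r : ℂ) • g : X) : S →ᵇ ℂ) x
        - ((f : S →ᵇ ℂ) x - c) - r * ((g : S →ᵇ ℂ) x - c) := by
      simp; ring
    have hrn : ‖(1 + (r : ℂ)) * c‖ = (1 + r) * ‖c‖ := by
      have : (1 + (r : ℂ)) = ((1 + r : ℝ) : ℂ) := by push_cast; rfl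
      rw [norm_mul, this, Complex.norm_real, Real.norm_of_nonneg (by linarith)]
    have hrg : ‖(r : ℂ) * ((g : S →ᵇ ℂ) x - c)‖ ≤ r * δ := by
      rw [norm_mul, Complex.norm_real, Real.norm_of_nonneg hr]; gcongr
    have h1 : (1 + r) * ‖c‖ ≤ ‖f + (r : ℂ) • g‖ + 4 * δ + r * δ := by
      rw [← hrn, hval]
      refine (norm_sub_le _ _).trans ?_
      have := norm_sub_le (((f + (r : ℂ) • g : X) : S →ᵇ ℂ) x) ((f : S →ᵇ ℂ) x - c)
      linarith
    nlinarith

/-! ### Peak functions on the closed unit disc. -/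

/-- For `t > 0` and small `α > 0`, this function on the closed unit disc peaks at `1`; it is close
to `0` away from `1` when `t` is small, and its values lie in a thin sector around `[0, 1]`. -/
noncomputable def discPeak (α t : ℝ) (z : ℂ) : ℂ := ((t : ℂ) / (t + (1 - z))) ^ (α : ℂ)

section discPeak

variable {α t : ℝ} {z : ℂ}

theorem re_one_sub_nonneg (hz : ‖z‖ ≤ 1) : 0 ≤ (1 - z).re := by
  have := (Complex.re_le_norm z).trans hz
  simpa using this

theorem le_norm_ofReal_add_one_sub (hz : ‖z‖ ≤ 1) : t ≤ ‖(t : ℂ) + (1 - z)‖ := by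
  refine le_trans ?_ (Complex.re_le_norm _)
  have := re_one_sub_nonneg hz
  rw [Complex.add_re, Complex.ofReal_re]
  linarith

theorem norm_one_sub_le_norm_ofReal_add (ht : 0 < t) (hz : ‖z‖ ≤ 1) :
    ‖1 - z‖ ≤ ‖(t : ℂ) + (1 - z)‖ := by
  have := re_one_sub_nonneg hz
  rw [← sq_le_sq₀ (norm_nonneg _) (norm_nonneg _), Complex.sq_norm, Complex.sq_norm,
    Complex.normSq_apply, Complex.normSq_apply]
  simp only [Complex.add_re, Complex.add_im, Complex.ofReal_re, Complex.ofReal_im, zero_add]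
  nlinarith [mul_nonneg ht.le this]

theorem div_ofReal_add_one_sub_mem_slitPlane (ht : 0 < t) (hz : ‖z‖ ≤ 1) :
    (t : ℂ) / (t + (1 - z)) ∈ Complex.slitPlane := by
  refine Or.inl ?_
  have h0 := le_norm_ofReal_add_one_sub (t := t) hz
  have h1 := re_one_sub_nonneg hz
  rw [div_eq_mul_inv, Complex.re_ofReal_mul, Complex.inv_re]
  refine mul_pos ht (div_pos ?_ (Complex.normSq_pos.2 (norm_pos_iff.1 (ht.trans_le h0))))
  rw [Complex.add_re, Complex.ofReal_re]
  linarith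

theorem norm_discPeak (ht : 0 < t) :
    ‖discPeak α t z‖ = (t / ‖(t : ℂ) + (1 - z)‖) ^ α := by
  rw [discPeak, Complex.norm_cpow_real, norm_div, Complex.norm_real, Real.norm_of_nonneg ht.le]

theorem norm_discPeak_le_one (hα : 0 < α) (ht : 0 < t) (hz : ‖z‖ ≤ 1) :
    ‖discPeak α t z‖ ≤ 1 := by
  rw [norm_discPeak ht]
  exact Real.rpow_le_one (by positivity)
    (div_le_one_of_le₀ (le_norm_ofReal_add_one_sub hz) (norm_nonneg _)) hα.le

theorem norm_discPeak_le_of_le (hα : 0 < α) (ht : 0 < t) (hz : ‖z‖ ≤ 1) {s : ℝ} (hs : 0 < s)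
    (hsz : s ≤ ‖1 - z‖) : ‖discPeak α t z‖ ≤ (t / s) ^ α := by
  rw [norm_discPeak ht]
  have := hsz.trans (norm_one_sub_le_norm_ofReal_add ht hz)
  gcongr

/-- The power `α` multiplies arguments by `α`, so each value is within `α * π` of its own modulus, a
point of `[0, 1]`, where the sum is exactly one. -/
theorem norm_discPeak_add_norm_one_sub_le (hα : 0 < α) (ht : 0 < t) (hz : ‖z‖ ≤ 1) :
    ‖discPeak α t z‖ + ‖1 - discPeak α t z‖ ≤ 1 + α * Real.pi := by
  have hle := norm_discPeak_le_one hα ht hz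
  set q : ℂ := (t : ℂ) / (t + (1 - z)) with hq
  have hq0 : q ≠ 0 := Complex.slitPlane_ne_zero (div_ofReal_add_one_sub_mem_slitPlane ht hz)
  set ρ := ‖discPeak α t z‖ with hρ
  have hexp : discPeak α t z = ρ * Complex.exp (Complex.I * ((q.arg * α : ℝ) : ℂ)) := by
    have h1 : discPeak α t z = Complex.exp (Complex.log q * α) := Complex.cpow_def_of_ne_zero hq0 _
    have h2 : ρ = Real.exp (Real.log ‖q‖ * α) := by
      rw [hρ, h1, Complex.norm_exp]
      simp [Complex.log_re]
    rw [h1, h2, Complex.ofReal_exp, ← Complex.exp_add]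
    congr 1
    apply Complex.ext <;> simp [Complex.log_re, Complex.log_im]
  have harg : ‖q.arg * α‖ ≤ α * Real.pi := by
    rw [norm_mul, Real.norm_of_nonneg hα.le, mul_comm]
    gcongr
    exact Complex.abs_arg_le_pi q
  have hdecomp : 1 - discPeak α t z = ((1 - ρ : ℝ) : ℂ)
      - ρ * (Complex.exp (Complex.I * ((q.arg * α : ℝ) : ℂ)) - 1) := by
    rw [hexp]; push_cast; ring
  have h1 : ‖1 - discPeak α t z‖ ≤ (1 - ρ) + 1 * (α * Real.pi) := by
    rw [hdecomp]
    refine (norm_sub_le _ _).trans ?_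
    rw [Complex.norm_real, Real.norm_of_nonneg (by linarith), norm_mul, Complex.norm_real,
      Real.norm_of_nonneg (norm_nonneg _)]
    gcongr
    exact Real.norm_exp_I_mul_ofReal_sub_one_le.trans harg
  linarith

theorem differentiableAt_discPeak (ht : 0 < t) (hz : ‖z‖ ≤ 1) :
    DifferentiableAt ℂ (discPeak α t) z := by
  have h0 : (t : ℂ) + (1 - z) ≠ 0 :=
    norm_pos_iff.1 (ht.trans_le (le_norm_ofReal_add_one_sub hz))
  refine DifferentiableAt.cpow ?_ (differentiableAt_const _)
    (div_ofReal_add_one_sub_mem_slitPlane ht hz)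
  fun_prop (disch := exact h0)

theorem discPeak_one (ht : 0 < t) : discPeak α t 1 = 1 := by
  have : (t : ℂ) ≠ 0 := by exact_mod_cast ht.ne'
  simp [discPeak, this]

theorem uniformContinuousOn_discPeak (ht : 0 < t) :
    UniformContinuousOn (discPeak α t) (Metric.closedBall 0 1) :=
  (isCompact_closedBall 0 1).uniformContinuousOn_of_continuous fun _ hz =>
    (differentiableAt_discPeak ht (mem_closedBall_zero_iff.1 hz)).continuousAt.continuousWithinAt

theorem tendsto_discPeak_one (ht : 0 < t) : Tendsto (discPeak α t) (𝓝 1) (𝓝 1) := by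
  have := (differentiableAt_discPeak (α := α) ht (z := 1) (by simp)).continuousAt.tendsto
  rwa [discPeak_one ht] at this

theorem eventually_norm_discPeak_le {τ : ℕ → ℝ} (hα : 0 < α) (hτ : ∀ n, 0 < τ n)
    (hτ0 : Tendsto τ atTop (𝓝 0)) {s δ : ℝ} (hs : 0 < s) (hδ : 0 < δ) :
    ∀ᶠ m in atTop, ∀ z : ℂ, ‖z‖ ≤ 1 → s ≤ ‖1 - z‖ → ‖discPeak α (τ m) z‖ ≤ δ := by
  have hlim : Tendsto (fun m => (τ m / s) ^ α) atTop (𝓝 0) := by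
    have := (hτ0.div_const s).rpow_const (p := α) (Or.inr hα.le)
    rwa [zero_div, Real.zero_rpow hα.ne'] at this
  filter_upwards [hlim.eventually (eventually_le_nhds hδ)] with m hm z hz hsz
  exact (norm_discPeak_le_of_le hα (hτ m) hz hs hsz).trans hm

/-- Near `1` the first factor is small by continuity of the fixed peak; away from `1` the second is
small once `τ m` is. -/
theorem eventually_norm_one_sub_discPeak_mul_le {τ : ℕ → ℝ} (hα : 0 < α) (hτ : ∀ n, 0 < τ n)
    (hτ0 : Tendsto τ atTop (𝓝 0)) {δ : ℝ} (hδ : 0 < δ) (ht : 0 < t) :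
    ∀ᶠ m in atTop, ∀ z : ℂ, ‖z‖ ≤ 1 → ‖(1 - discPeak α t z) * discPeak α (τ m) z‖ ≤ δ := by
  obtain ⟨s, hs, hs'⟩ := Metric.tendsto_nhds_nhds.1 (tendsto_discPeak_one (α := α) ht) δ hδ
  filter_upwards [eventually_norm_discPeak_le hα hτ hτ0 hs (half_pos hδ)] with m hm z hz
  rw [norm_mul]
  rcases lt_or_ge ‖1 - z‖ s with h | h
  · have h1 : ‖1 - discPeak α t z‖ ≤ δ := by
      have := hs' (x := z) (by rwa [dist_eq_norm, norm_sub_rev])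
      rw [dist_eq_norm, norm_sub_rev] at this
      exact this.le
    calc _ ≤ δ * 1 := by gcongr; exact norm_discPeak_le_one hα (hτ m) hz
      _ = δ := mul_one δ
  · have h1 : ‖1 - discPeak α t z‖ ≤ 2 := by
      refine (norm_sub_le _ _).trans ?_
      rw [norm_one]
      linarith [norm_discPeak_le_one hα ht hz]
    calc _ ≤ 2 * (δ / 2) := by gcongr; exact hm z hz h
      _ = δ := by ring

end discPeak

/-! ### Near-maximum points and supporting functionals. -/

theorem exists_norm_eq_le_norm {G : ℂ → ℂ} (hG : DifferentiableOn ℂ G (Metric.ball 0 1))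
    {r s : ℝ} (hr : 0 ≤ r) (hrs : r ≤ s) (hs : 0 < s) (hs1 : s < 1) :
    ∃ w : ℂ, ‖w‖ = s ∧ ‖G r‖ ≤ ‖G w‖ := by
  have hd : DiffContOnCl ℂ G (Metric.ball 0 s) := by
    refine DifferentiableOn.diffContOnCl (hG.mono ?_)
    rw [closure_ball _ hs.ne']
    exact Metric.closedBall_subset_ball hs1
  obtain ⟨w, hw, hmax⟩ := Complex.exists_mem_frontier_isMaxOn_norm Metric.isBounded_ball
    ⟨0, Metric.mem_ball_self hs⟩ hd
  rw [frontier_ball _ hs.ne', mem_sphere_zero_iff_norm] at hw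
  refine ⟨w, hw, hmax ?_⟩
  rw [closure_ball _ hs.ne', mem_closedBall_zero_iff, Complex.norm_real, Real.norm_of_nonneg hr]
  exact hrs

/-- Hahn–Banach separates real parts only; rotating `x` inside the balanced set `V` upgrades this to
moduli, and dividing by `f y` normalises. -/
theorem exists_dual_norm_lt_one {E : Type*} [NormedAddCommGroup E] [NormedSpace ℂ E] {V : Set E}
    (hV_open : IsOpen V) (hV_balanced : Balanced ℂ V) (hV_convex : Convex ℝ V)
    (hV_zero : (0 : E) ∈ V) {y : E} (hy : y ∉ V) :
    ∃ ψ : E →L[ℂ] ℂ, ψ y = 1 ∧ ∀ x ∈ V, ‖ψ x‖ < 1 := by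
  obtain ⟨f, hf⟩ := RCLike.geometric_hahn_banach_open_point (𝕜 := ℂ) hV_convex hV_open hy
  have hpos : 0 < ‖f y‖ := by
    have h0 := hf 0 hV_zero
    simp only [map_zero] at h0
    exact h0.trans_le (RCLike.re_le_norm _)
  have hlt : ∀ x ∈ V, ‖f x‖ < ‖f y‖ := by
    intro x hx
    obtain ⟨θ, hθ, hθx⟩ := RCLike.exists_norm_eq_mul_self (f x)
    have h := hf (θ • x) (hV_balanced.smul_mem hθ.le hx)
    rw [map_smul, smul_eq_mul, ← hθx, RCLike.ofReal_re] at h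
    exact h.trans_le (RCLike.re_le_norm _)
  refine ⟨(f y)⁻¹ • f, ?_, fun x hx => ?_⟩
  · simp [norm_pos_iff.1 hpos]
  · rw [smul_apply, norm_smul, norm_inv, inv_mul_lt_iff₀ hpos, mul_one]
    exact hlt x hx

/-- Boundedness of `V` makes the gauge positive off `0`, so nonzero vectors can be normalised. For
`x = 0` any normalised vector serves, which requires `E` to be nontrivial. -/
theorem exists_gauge_eq_one_smul {E : Type*} [NormedAddCommGroup E] [NormedSpace ℂ E]
    [Nontrivial E] {V : Set E} (hV_bounded : Bornology.IsBounded V) (hV_open : IsOpen V)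
    (hV_balanced : Balanced ℂ V) (hV_zero : (0 : E) ∈ V) (x : E) :
    ∃ y : E, gauge V y = 1 ∧ x = ((gauge V x : ℝ) : ℂ) • y := by
  have hpos : ∀ z : E, z ≠ 0 → 0 < gauge V z := fun z hz =>
    (gauge_pos (absorbent_nhds_zero (hV_open.mem_nhds hV_zero))
      ((NormedSpace.isVonNBounded_iff ℝ).2 hV_bounded)).2 hz
  have hone : ∀ z : E, z ≠ 0 → gauge V (((gauge V z : ℝ) : ℂ)⁻¹ • z) = 1 := fun z hz => by
    rw [gauge_smul hV_balanced, norm_inv, Complex.norm_real, Real.norm_of_nonneg (hpos z hz).le,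
      inv_mul_cancel₀ (hpos z hz).ne']
  rcases eq_or_ne x 0 with rfl | hx
  · obtain ⟨z, hz⟩ := exists_ne (0 : E)
    exact ⟨_, hone z hz, by simp⟩
  · refine ⟨_, hone x hx, ?_⟩
    rw [smul_smul, mul_inv_cancel₀ (by exact_mod_cast (hpos x hx).ne'), one_smul]

/-- A norm one bounded holomorphic function on `V` is, along a sequence approaching a point where
some functional of norm one on `V` attains its norm, nearly constant of modulus nearly one. -/
theorem exists_dual_tendsto_one {E : Type*} [NormedAddCommGroup E] [NormedSpace ℂ E]
    [Nontrivial E] {V : Set E} (hV_bounded : Bornology.IsBounded V) (hV_open : IsOpen V)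
    (hV_balanced : Balanced ℂ V) (hV_convex : Convex ℝ V) (hV_zero : (0 : E) ∈ V)
    {g : V →ᵇ ℂ} (hg : g ∈ HInfty V) (hg1 : ‖g‖ = 1) {δ : ℝ} (hδ : 0 < δ) :
    ∃ (ψ : E →L[ℂ] ℂ) (c : ℂ) (x : ℕ → V), (∀ v ∈ V, ‖ψ v‖ < 1) ∧ ‖c‖ ≤ 1 ∧ 1 - δ ≤ ‖c‖ ∧
      Tendsto (fun n => ψ (x n)) atTop (𝓝 1) ∧ Tendsto (fun n => g (x n)) atTop (𝓝 c) := by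
  have : Nonempty V := ⟨⟨0, hV_zero⟩⟩
  obtain ⟨F, hF, hFg⟩ := hg
  have hgle : ∀ v, ‖g v‖ ≤ 1 := fun v => (g.norm_coe_le_norm v).trans hg1.le
  obtain ⟨x₀, hx₀⟩ : ∃ x₀, 1 - δ < ‖g x₀‖ :=
    exists_lt_of_lt_ciSup (by rw [← g.norm_eq_iSup_norm, hg1]; linarith)
  have hmem : ∀ z, z ∈ V ↔ gauge V z < 1 := fun z => by
    conv_lhs => rw [← setOfPred_gauge_lt_one_eq_self_of_isOpen hV_convex hV_zero hV_open]
    rfl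
  obtain ⟨y, hy, hxy⟩ := exists_gauge_eq_one_smul hV_bounded hV_open hV_balanced hV_zero (x₀ : E)
  set r := gauge V (x₀ : E) with hr
  have hr0 : 0 ≤ r := gauge_nonneg _
  have hr1 : r < 1 := (hmem _).1 x₀.2
  obtain ⟨ψ, hψy, hψ⟩ := exists_dual_norm_lt_one hV_open hV_balanced hV_convex hV_zero (y := y)
    (by rw [hmem, hy]; exact lt_irrefl 1)
  have hsmul : ∀ w : ℂ, ‖w‖ < 1 → w • y ∈ V := fun w hw => by
    rwa [hmem, gauge_smul hV_balanced, hy, mul_one]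
  have hG : DifferentiableOn ℂ (fun w : ℂ => F (w • y)) (Metric.ball 0 1) :=
    hF.comp (by fun_prop) fun w hw => hsmul w (mem_ball_zero_iff.1 hw)
  -- The maximum with `r` keeps `x₀` inside the disc of radius `s n`; the `+ 2` keeps the radius
  -- positive even at `n = 0` with `r = 0`.
  set s : ℕ → ℝ := fun n => max r (1 - 1 / ((n : ℝ) + 2)) with hs
  have hs1 : ∀ n, s n < 1 := fun n => max_lt hr1 (by
    have : 0 < 1 / ((n : ℝ) + 2) := by positivity
    linarith)
  have hs0 : ∀ n, 0 < s n := fun n => lt_max_of_lt_right (by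
    rw [sub_pos, div_lt_one (by positivity)]
    linarith [n.cast_nonneg (α := ℝ)])
  choose w hw hwG using fun n : ℕ =>
    exists_norm_eq_le_norm hG hr0 (le_max_left r (1 - 1 / ((n : ℝ) + 2))) (hs0 n) (hs1 n)
  set x : ℕ → V := fun n => ⟨w n • y, hsmul _ ((hw n).trans_lt (hs1 n))⟩ with hx
  have hgx : ∀ n, 1 - δ ≤ ‖g (x n)‖ := fun n => by
    have h1 := hwG n
    beta_reduce at h1
    rw [← hxy, hFg x₀] at h1
    rw [← hFg (x n)]
    exact hx₀.le.trans h1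
  -- Compactness in `ℂ × ℂ` makes `w` and the values of `g` converge along the same subsequence.
  obtain ⟨⟨ζ, c⟩, -, σ, hσ, hlim⟩ := tendsto_subseq_of_bounded
    (Metric.isBounded_closedBall (x := (0 : ℂ × ℂ)) (r := 1)) (x := fun n => (w n, g (x n)))
    (fun n => by
      rw [mem_closedBall_zero_iff]
      exact max_le ((hw n).trans_le (hs1 n).le) (hgle _))
  have hwζ : Tendsto (fun n => w (σ n)) atTop (𝓝 ζ) := (continuous_fst.tendsto _).comp hlim
  have hgc : Tendsto (fun n => g (x (σ n))) atTop (𝓝 c) := (continuous_snd.tendsto _).comp hlim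
  have hslim : Tendsto s atTop (𝓝 1) := by
    have h1 : Tendsto (fun n : ℕ => 1 / ((n : ℝ) + 2)) atTop (𝓝 0) := by
      have := (tendsto_natCast_atTop_atTop (R := ℝ)).atTop_add (tendsto_const_nhds (x := (2 : ℝ)))
      simpa only [one_div] using! this.inv_tendsto_atTop
    have := (tendsto_const_nhds (x := r)).max (h1.const_sub 1)
    rwa [sub_zero, max_eq_right hr1.le] at this
  have hζ : ‖ζ‖ = 1 := by
    refine tendsto_nhds_unique hwζ.norm ?_
    simp only [hw]
    exact hslim.comp hσ.tendsto_atTop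
  -- Along the subsequence `ψ` tends to the unimodular `ζ`; multiplying by its conjugate moves the
  -- limit to `1`.
  refine ⟨(starRingEnd ℂ ζ) • ψ, c, fun n => x (σ n), fun v hv => ?_,
    le_of_tendsto' hgc.norm fun n => hgle _, ge_of_tendsto' hgc.norm fun n => hgx _, ?_, hgc⟩
  · rw [smul_apply, norm_smul, RCLike.norm_conj, hζ, one_mul]
    exact hψ v hv
  · have h1 := hwζ.const_mul (starRingEnd ℂ ζ)
    rw [Complex.conj_mul', hζ] at h1
    simpa [hx, hψy, mul_comm] using h1

/-! ### Peak functions on `V` and the conclusion. -/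

/-- The composition of a disc peak function with a functional bounded by one on `V`. -/
noncomputable def functionalPeak {E : Type*} [NormedAddCommGroup E] [NormedSpace ℂ E] {V : Set E}
    (ψ : E →L[ℂ] ℂ) (hψ : ∀ v ∈ V, ‖ψ v‖ < 1) {α t : ℝ} (hα : 0 < α) (ht : 0 < t) : V →ᵇ ℂ :=
  BoundedContinuousFunction.ofNormedAddCommGroup (fun v : V => discPeak α t (ψ v))
    (continuous_iff_continuousAt.2 fun v =>
      (differentiableAt_discPeak ht (hψ v v.2).le).continuousAt.comp
        (f := fun v : V => ψ v) (by fun_prop))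
    1 fun v => norm_discPeak_le_one hα ht (hψ v v.2).le

section functionalPeak

variable {E : Type*} [NormedAddCommGroup E] [NormedSpace ℂ E] {V : Set E}
  (ψ : E →L[ℂ] ℂ) (hψ : ∀ v ∈ V, ‖ψ v‖ < 1) {α t : ℝ} (hα : 0 < α) (ht : 0 < t)

theorem functionalPeak_mem_HInfty : functionalPeak ψ hψ hα ht ∈ HInfty V :=
  ⟨fun v => discPeak α t (ψ v), fun v hv =>
    ((differentiableAt_discPeak ht (hψ v hv).le).comp v
      ψ.differentiableAt).differentiableWithinAt, fun _ => rfl⟩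

theorem functionalPeak_mem_AUnif : functionalPeak ψ hψ hα ht ∈ AUnif V := by
  refine ⟨functionalPeak_mem_HInfty ψ hψ hα ht, ?_⟩
  rw [← uniformContinuousOn_univ]
  exact (uniformContinuousOn_discPeak (α := α) ht).comp (f := fun v : V => ψ v)
    (ψ.uniformContinuous.comp uniformContinuous_subtype_val).uniformContinuousOn
    fun v _ => mem_closedBall_zero_iff.2 (hψ v v.2).le

/-- On `closure V` only `‖ψ‖ ≤ 1` survives, but `discPeak` is continuous on the whole closed disc,
since its pole `1 + t` lies outside. -/
theorem functionalPeak_mem_AInfty : functionalPeak ψ hψ hα ht ∈ AInfty V := by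
  refine ⟨functionalPeak_mem_HInfty ψ hψ hα ht, fun v => discPeak α t (ψ v), ?_, fun _ => rfl⟩
  have hcl : Set.MapsTo ψ (closure V) (Metric.closedBall 0 1) := by
    refine Set.MapsTo.closure_left (fun v hv => ?_) ψ.continuous Metric.isClosed_closedBall
    exact mem_closedBall_zero_iff.2 (hψ v hv).le
  exact (uniformContinuousOn_discPeak ht).continuousOn.comp ψ.continuous.continuousOn hcl

end functionalPeak

theorem daugavetProperty_of_functionalPeak_mem {E : Type*} [NormedAddCommGroup E]
    [NormedSpace ℂ E] [Nontrivial E] {V : Set E} (hV_bounded : Bornology.IsBounded V)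
    (hV_open : IsOpen V) (hV_balanced : Balanced ℂ V) (hV_convex : Convex ℝ V)
    (hV_zero : (0 : E) ∈ V) (X : Subalgebra ℂ (V →ᵇ ℂ)) (hX : X ≤ HInfty V)
    (hpeak : ∀ (ψ : E →L[ℂ] ℂ) (hψ : ∀ v ∈ V, ‖ψ v‖ < 1) (α t : ℝ) (hα : 0 < α) (ht : 0 < t),
      functionalPeak ψ hψ hα ht ∈ X) :
    DaugavetProperty ℂ X := by
  refine daugavetProperty_of_peak X fun g hg hg1 δ hδ => ?_
  obtain ⟨ψ, c, x, hψ, hc, hc', hψx, hgx⟩ := exists_dual_tendsto_one hV_bounded hV_open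
    hV_balanced hV_convex hV_zero (hX hg) hg1 hδ
  -- With this exponent the sector error `α * π` is exactly `δ`.
  have hα : 0 < δ / Real.pi := div_pos hδ Real.pi_pos
  set τ : ℕ → ℝ := fun n => 1 / ((n : ℝ) + 1) with hτ
  have hτpos : ∀ n, 0 < τ n := fun n => Nat.one_div_pos_of_nat
  have hτ0 : Tendsto τ atTop (𝓝 0) := tendsto_one_div_add_atTop_nhds_zero_nat
  refine ⟨c, fun n => functionalPeak ψ hψ hα (hτpos n), hc, hc', fun n => hpeak _ _ _ _ _ _,
    fun n v => norm_discPeak_le_one hα (hτpos n) (hψ v v.2).le, fun n v => ?_, fun n => ?_,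
    fun n => ?_⟩
  · have := norm_discPeak_add_norm_one_sub_le hα (hτpos n) (hψ v v.2).le
    rwa [div_mul_cancel₀ _ Real.pi_ne_zero] at this
  · filter_upwards [eventually_norm_one_sub_discPeak_mul_le hα hτpos hτ0 hδ (hτpos n)]
      with m hm v using hm _ (hψ v v.2).le
  · have h1 := ((tendsto_discPeak_one (α := δ / Real.pi) (hτpos n)).comp hψx).eventually
      (Metric.closedBall_mem_nhds _ hδ)
    obtain ⟨i, hi, hi'⟩ := (h1.and (hgx.eventually (Metric.closedBall_mem_nhds _ hδ))).exists
    refine ⟨x i, ?_, ?_, ?_⟩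
    · rw [norm_sub_rev]
      exact mem_closedBall_iff_norm.1 hi
    · exact mem_closedBall_iff_norm.1 hi'
    -- The strict inequality `‖ψ‖ < 1` on `V` keeps `ψ (x i)` away from `1`, so narrower peaks
    -- eventually vanish there up to `δ`.
    · have hlt := hψ (x i) (x i).2
      have hpos : 0 < ‖1 - ψ (x i)‖ := by
        refine norm_pos_iff.2 (sub_ne_zero.2 fun h => ?_)
        rw [← h, norm_one] at hlt
        exact lt_irrefl _ hlt
      filter_upwards [eventually_norm_discPeak_le hα hτpos hτ0 hpos hδ] with m hm
      exact hm _ hlt.le le_rfl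

theorem corollary2p3 {E : Type*} [NormedAddCommGroup E] [NormedSpace ℂ E] [CompleteSpace E]
    [Nontrivial E] (V : Set E) (hV_bounded : Bornology.IsBounded V) (hV_open : IsOpen V)
    (hV_balanced : Balanced ℂ V) (hV_convex : Convex ℝ V) (hV_zero : (0 : E) ∈ V) :
    DaugavetProperty ℂ (AUnif V) ∧ DaugavetProperty ℂ (AInfty V) ∧
      DaugavetProperty ℂ (HInfty V) := by
  have key := daugavetProperty_of_functionalPeak_mem hV_bounded hV_open hV_balanced hV_convex
    hV_zero
  exact ⟨key _ (fun _ h => h.1) fun ψ hψ _ _ hα ht => functionalPeak_mem_AUnif ψ hψ hα ht,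
    key _ (fun _ h => h.1) fun ψ hψ _ _ hα ht => functionalPeak_mem_AInfty ψ hψ hα ht,
    key _ le_rfl fun ψ hψ _ _ hα ht => functionalPeak_mem_HInfty ψ hψ hα ht⟩
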